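/- Let $P$ and $Q$ be probability measures on $\mathbf R^I$ and $\mathbf R^J$ with finite second moments, let $\Pi(P,Q)$ be the set of probability measures on $\mathbf R^I\times\mathbf R^J$ with marginals $P$ and $Q$ (couplings), and for $(X,Y)\sim\pi\in\Pi(P,Q)$ let $\sigma_\pi=(\mathbf E_\pi(X_iY_j))_{i,j}$. Let $\mathcal F(P,Q)=\{\sigma_\pi:\pi\in\Pi(P,Q)\}\subset\mathbf M_{I,J}(\mathbf R)$. Let $B\subset \mathbf M_{I,J}(\mathbf R)$ be a compact convex set with $0\notin B$, let $K(B)=\{y\in\mathbf M_{I,J}(\mathbf R): \mathrm{Tr}(x'y)\ge 0\ \ \forall x\in B\}$, and write $M_1\succ_{K(B)}M_2$ if $M_1-M_2\in\mathrm{Int}(K(B))$. For $\pi\in\Pi(P,Q)$ and $(X,Y)\sim\pi$, the following are equivalent: (i) $\pi$ has positive extreme dependence with respect to $\succ_{K(B)}$, that is, $\sigma_\pi$ is maximal in $\mathcal F(P,Q)$: there is no $\Sigma\in\mathcal F(P,Q)$ with $\Sigma\succ_{K(B)}\sigma_\pi$; (ii) there exists $M\in B$ such that $\mathrm{Tr}(M'\sigma_\pi)=\sup_{\tilde\pi\in\Pi(P,Q)}\mathrm{Tr}(M'\sigma_{\tilde\pi})$;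 (ii') there exists $M\in B$ such that $\mathbf E_\pi(X'MY)=\sup_{\tilde\pi\in\Pi(P,Q)}\mathbf E_{\tilde\pi}(X'MY)$; (iii) there exist $M\in B$ and a proper convex function $u:\mathbf R^I\to\mathbf R\cup\{+\infty\}$ such that $MY\in\partial u(X)$ almost surely, where $\partial u(x_0)=\{v: u(x)\ge u(x_0)+v\cdot(x-x_0)\ \ \forall x\in\mathbf R^I\}$ if $u(x_0)<+\infty$ and $\partial u(x_0)=\emptyset$ otherwise. In particular, every coupling $\pi$ with positive extreme dependence has extreme dependence, i.e. $\sigma_\pi$ lies on the boundary of $\mathcal F(P,Q)$. -/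

import Mathlib

open MeasureTheory Matrix

/-- The couplings of `P` and `Q`: measures on the product with marginals `P` and `Q`
(automatically probability measures when `P` is one). -/
def couplings {I J : Type*} (P : Measure (I → ℝ)) (Q : Measure (J → ℝ)) :
    Set (Measure ((I → ℝ) × (J → ℝ))) :=
  {π | π.fst = P ∧ π.snd = Q}

/-- The cross-covariance matrix `σ_π`, with entries `E_π(X_i Y_j)`. -/
noncomputable def crossCov {I J : Type*} (π : Measure ((I → ℝ) × (J → ℝ))) : Matrix I J ℝ :=
  Matrix.of fun i j => ∫ z, z.1 i * z.2 j ∂π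

/-- The covariance set `F(P, Q)`. -/
def covarianceSet {I J : Type*} (P : Measure (I → ℝ)) (Q : Measure (J → ℝ)) :
    Set (Matrix I J ℝ) :=
  {S | ∃ π ∈ couplings P Q, ∀ i j, S i j = ∫ z, z.1 i * z.2 j ∂π}

/-- The scalar product `M · N = Tr(M' N)` of matrices. -/
def matDot {I J : Type*} [Fintype I] [Fintype J] (M N : Matrix I J ℝ) : ℝ :=
  (Mᵀ * N).trace

/-- A compact basis: a compact convex set of matrices that does not contain `0`. -/
structure IsCompactBasis {I J : Type*} (B : Set (Matrix I J ℝ)) : Prop where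
  isCompact : IsCompact B
  convex : Convex ℝ B
  zero_notMem : (0 : Matrix I J ℝ) ∉ B

/-- The closed convex cone `K(B)` of all `y` with `x · y ≥ 0` for every `x ∈ B`. -/
def basisCone {I J : Type*} [Fintype I] [Fintype J] (B : Set (Matrix I J ℝ)) :
    Set (Matrix I J ℝ) :=
  {y | ∀ x ∈ B, 0 ≤ matDot x y}

/-- The strict conic order: `M₁ ≻ M₂` when `M₁ - M₂` is in the interior of `K(B)`. -/
def ConicGT {I J : Type*} [Fintype I] [Fintype J] (B : Set (Matrix I J ℝ))
    (M₁ M₂ : Matrix I J ℝ) : Prop :=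
  M₁ - M₂ ∈ interior (basisCone B)

/-- `A` is a maximal element of `S` for the strict conic order: no element of `S` strictly
dominates it. -/
def IsConicMaximal {I J : Type*} [Fintype I] [Fintype J] (B S : Set (Matrix I J ℝ))
    (A : Matrix I J ℝ) : Prop :=
  A ∈ S ∧ ∀ A' ∈ S, ¬ ConicGT B A' A

/-- Extreme dependence: `π` is a coupling and `σ_π` lies on the boundary of `F(P, Q)`. -/
def ExtremeDependence {I J : Type*} (P : Measure (I → ℝ)) (Q : Measure (J → ℝ))
    (π : Measure ((I → ℝ) × (J → ℝ))) : Prop :=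
  π ∈ couplings P Q ∧ crossCov π ∈ frontier (covarianceSet P Q)

/-- Positive extreme dependence with respect to the strict conic order of `B`: `π` is a coupling
and `σ_π` is maximal in `F(P, Q)`. -/
def PositiveExtremeDependence {I J : Type*} [Fintype I] [Fintype J] (B : Set (Matrix I J ℝ))
    (P : Measure (I → ℝ)) (Q : Measure (J → ℝ)) (π : Measure ((I → ℝ) × (J → ℝ))) : Prop :=
  π ∈ couplings P Q ∧ IsConicMaximal B (covarianceSet P Q) (crossCov π)

/-- A proper convex function `u : ℝ^I → ℝ ∪ {+∞}`: it never takes the value `-∞`, is not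
identically `+∞`, and has a convex epigraph. -/
structure IsProperConvex {I : Type*} (u : (I → ℝ) → EReal) : Prop where
  ne_bot : ∀ x, u x ≠ ⊥
  exists_ne_top : ∃ x, u x ≠ ⊤
  convex_epigraph : Convex ℝ {p : (I → ℝ) × ℝ | u p.1 ≤ (p.2 : EReal)}

/-- The subdifferential `∂u(x₀)`: the vectors `v` with `u(x) ≥ u(x₀) + v · (x - x₀)` for all `x`;
as usual it is empty where `u` is not finite. -/
def subdiff {I : Type*} [Fintype I] (u : (I → ℝ) → EReal) (x₀ : I → ℝ) : Set (I → ℝ) :=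
  {v | u x₀ ≠ ⊤ ∧ u x₀ ≠ ⊥ ∧ ∀ x, u x₀ + ((v ⬝ᵥ (x - x₀) : ℝ) : EReal) ≤ u x}

/-! Order side: the interior of `K(B)` consists of the matrices pairing strictly positively with all
of `B` (`mem_interior_basisCone`). Since mixtures of couplings are couplings, the covariance set is
convex. If `σ_π` is maximal, Hahn–Banach separates the covariance set from `σ_π + Int K(B)`; the
separating form is positive on `Int K(B)`, and a second separation shows that a nonnegative multiple
of it lies in `B` (`exists_smul_mem_of_forall_interior_pos`). So maximality means maximising a
linear form `M ∈ B`, which is nonzero, whence the boundary statement.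

Transport side: second moments make `Tr(M'σ_π)` equal to `E(X'MY)`, so a maximiser is an optimal
plan for a bilinear profit. Optimality forces the support to be cyclically monotone
(`sum_le_sum_of_mem_support`), and Rockafellar's construction gives `u`. Conversely, Fenchel–Young
for the pair `u**`, `u*` is an equality on the graph of `∂u` and an inequality wherever both are
finite; as the integrals of the two potentials depend only on the marginals, this dual certificate
gives optimality (`integral_le_integral_of_dual`). -/

/-! ### Cones with compact basis and separation of convex sets. -/

section Conic

variable {I J : Type*} [Fintype I] [Fintype J]

theorem matDot_eq_sum (M N : Matrix I J ℝ) : matDot M N = ∑ i, ∑ j, M i j * N i j := by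
  simp only [matDot, Matrix.trace, Matrix.diag, Matrix.mul_apply, Matrix.transpose_apply]
  exact Finset.sum_comm

theorem matDot_add (M N N' : Matrix I J ℝ) : matDot M (N + N') = matDot M N + matDot M N' := by
  simp [matDot, Matrix.mul_add]

theorem matDot_sub (M N N' : Matrix I J ℝ) : matDot M (N - N') = matDot M N - matDot M N' := by
  simp [matDot, Matrix.mul_sub]

theorem matDot_smul (M N : Matrix I J ℝ) (t : ℝ) : matDot M (t • N) = t * matDot M N := by
  simp [matDot]

theorem smul_matDot (M N : Matrix I J ℝ) (t : ℝ) : matDot (t • M) N = t * matDot M N := by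
  simp [matDot]

theorem continuous_matDot :
    Continuous fun p : Matrix I J ℝ × Matrix I J ℝ => matDot p.1 p.2 := by
  unfold matDot
  fun_prop

theorem matDot_self_pos {M : Matrix I J ℝ} (hM : M ≠ 0) : 0 < matDot M M := by
  have hnn : ∀ i, 0 ≤ ∑ j, M i j * M i j :=
    fun i => Finset.sum_nonneg fun j _ => mul_self_nonneg _
  rw [matDot_eq_sum]
  refine (Finset.sum_nonneg fun i _ => hnn i).lt_of_ne' fun h => hM ?_
  ext i j
  have h1 := (Finset.sum_eq_zero_iff_of_nonneg fun i _ => hnn i).1 h i (Finset.mem_univ i)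
  have h2 := (Finset.sum_eq_zero_iff_of_nonneg fun j _ => mul_self_nonneg (M i j)).1 h1 j
    (Finset.mem_univ j)
  simpa using h2

theorem exists_matDot_eq (f : Matrix I J ℝ →L[ℝ] ℝ) :
    ∃ N : Matrix I J ℝ, ∀ y, f y = matDot N y := by
  classical
  refine ⟨Matrix.of fun i j => f (Matrix.single i j 1), fun y => ?_⟩
  rw [matDot_eq_sum]
  conv_lhs => rw [Matrix.matrix_eq_sum_single y]
  simp only [map_sum, Matrix.of_apply]
  refine Finset.sum_congr rfl fun i _ => Finset.sum_congr rfl fun j _ => ?_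
  have : Matrix.single i j (y i j) = y i j • Matrix.single i j (1 : ℝ) := by simp
  rw [this, map_smul, smul_eq_mul, mul_comm]

theorem locallyConvexSpace_matrix : LocallyConvexSpace ℝ (Matrix I J ℝ) :=
  inferInstanceAs (LocallyConvexSpace ℝ (I → J → ℝ))

/-- For `y` interior, `y - t • x` stays in the cone for small `t > 0`; pairing with `x` gives `x · y
≥ t (x · x) > 0`. Conversely, compactness of `B` makes strict positivity persist on a neighbourhood
of `y` uniformly in `x ∈ B`. -/
theorem mem_interior_basisCone {B : Set (Matrix I J ℝ)} (hB : IsCompactBasis B)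
    {y : Matrix I J ℝ} : y ∈ interior (basisCone B) ↔ ∀ x ∈ B, 0 < matDot x y := by
  constructor
  · intro hy x hx
    have hx0 : x ≠ 0 := fun h => hB.zero_notMem (h ▸ hx)
    have hc : Filter.Tendsto (fun t : ℝ => y - t • x) (nhdsWithin 0 (Set.Ioi 0)) (nhds y) := by
      have : Continuous fun t : ℝ => y - t • x := by fun_prop
      simpa using (this.tendsto 0).mono_left nhdsWithin_le_nhds
    obtain ⟨t, ht, ht0⟩ :=
      ((hc.eventually (mem_interior_iff_mem_nhds.1 hy)).and self_mem_nhdsWithin).exists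
    have h := ht x hx
    rw [matDot_sub, matDot_smul] at h
    have := mul_pos (Set.mem_Ioi.1 ht0) (matDot_self_pos hx0)
    linarith
  · intro hy
    rw [mem_interior_iff_mem_nhds]
    have := hB.isCompact.eventually_forall_of_forall_eventually (x₀ := y)
      (P := fun y x => 0 < matDot x y) (fun x hx => by
        have hc : Continuous fun p : Matrix I J ℝ × Matrix I J ℝ => matDot p.2 p.1 :=
          continuous_matDot.comp continuous_swap
        exact hc.continuousAt.eventually (lt_mem_nhds (hy x hx)))
    filter_upwards [this] with z hz x hx using (hz x hx).le

omit [Fintype I] [Fintype J] in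
theorem isClosed_ray (N : Matrix I J ℝ) : IsClosed ((fun t : ℝ => t • N) '' Set.Ici 0) := by
  rcases eq_or_ne N 0 with rfl | hN
  · have : (fun t : ℝ => t • (0 : Matrix I J ℝ)) '' Set.Ici 0 = {0} := by
      ext x
      simp only [smul_zero, Set.mem_image, Set.mem_singleton_iff]
      exact ⟨fun ⟨_, _, h⟩ => h.symm, fun h => ⟨0, Set.mem_Ici.2 le_rfl, h.symm⟩⟩
    rw [this]
    exact isClosed_singleton
  · exact (isClosedEmbedding_smul_left hN).isClosedMap _ isClosed_Ici

/-- A matrix that is positive on the interior of `K(B)` is a positive multiple of a point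
of `B`. -/
theorem exists_smul_mem_of_forall_interior_pos {B : Set (Matrix I J ℝ)} (hB : IsCompactBasis B)
    {N : Matrix I J ℝ} (hN : ∀ y ∈ interior (basisCone B), 0 < matDot N y) :
    ∃ t : ℝ, 0 ≤ t ∧ t • N ∈ B := by
  by_contra! hcon
  have := locallyConvexSpace_matrix (I := I) (J := J)
  have hdisj : Disjoint B ((fun t : ℝ => t • N) '' Set.Ici 0) := by
    rw [Set.disjoint_left]
    rintro _ hx ⟨t, ht, rfl⟩
    exact hcon t ht hx
  have hconv : Convex ℝ ((fun t : ℝ => t • N) '' Set.Ici 0) :=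
    (convex_Ici (0 : ℝ)).linear_image (LinearMap.toSpanSingleton ℝ _ N)
  obtain ⟨f, u, v, hu, huv, hv⟩ :=
    geometric_hahn_banach_compact_closed hB.convex hB.isCompact hconv (isClosed_ray N) hdisj
  obtain ⟨Y, hY⟩ := exists_matDot_eq (-f)
  have hv0 : v < 0 := by simpa using hv _ ⟨0, Set.mem_Ici.2 le_rfl, rfl⟩
  have hcomm : ∀ M : Matrix I J ℝ, matDot M Y = -f M := fun M => by
    have := hY M
    rw [matDot_eq_sum] at this ⊢
    simpa [mul_comm] using this.symm
  have hYK : Y ∈ interior (basisCone B) := by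
    rw [mem_interior_basisCone hB]
    intro x hx
    rw [hcomm]
    linarith [hu x hx]
  have h1 := hN Y hYK
  rw [hcomm] at h1
  have hfN : f N < 0 := by linarith
  -- The multiple `v / f N` is nonnegative, so it stays on the ray, and is chosen so that `f` takes
  -- exactly the value `v` there, against strict separation.
  have h2 := hv _ ⟨v / f N, div_nonneg_of_nonpos hv0.le hfN.le, rfl⟩
  simp only [map_smul, smul_eq_mul, div_mul_cancel₀ _ hfN.ne] at h2
  exact lt_irrefl _ h2

/-- A maximal element of a convex set for the strict conic order maximises a linear form given
by a point of `B`. -/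
theorem IsConicMaximal.exists_forall_matDot_le {B S : Set (Matrix I J ℝ)} (hB : IsCompactBasis B)
    (hS : Convex ℝ S) {A : Matrix I J ℝ} (hA : IsConicMaximal B S A) :
    ∃ M ∈ B, ∀ A' ∈ S, matDot M A' ≤ matDot M A := by
  have := locallyConvexSpace_matrix (I := I) (J := J)
  have hint : ∀ y, A + y ∈ {y | y - A ∈ interior (basisCone B)} ↔
      y ∈ interior (basisCone B) := fun y => by simp
  have hKconv : Convex ℝ {y | y - A ∈ interior (basisCone B)} := by
    intro y hy z hz a b ha hb hab
    simp only [Set.mem_ofPred_eq, mem_interior_basisCone hB] at hy hz ⊢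
    intro x hx
    have h : a • y + b • z - A = a • (y - A) + b • (z - A) := by
      rw [smul_sub, smul_sub, sub_add_sub_comm, ← add_smul, hab, one_smul]
    rw [h, matDot_add, matDot_smul, matDot_smul]
    exact (convex_Ioi (0 : ℝ)) (hy x hx) (hz x hx) ha hb hab
  have hKopen : IsOpen {y | y - A ∈ interior (basisCone B)} :=
    isOpen_interior.preimage (by fun_prop : Continuous fun y : Matrix I J ℝ => y - A)
  have hdisj : Disjoint {y | y - A ∈ interior (basisCone B)} S :=
    Set.disjoint_left.2 fun y hy hyS => hA.2 y hyS hy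
  obtain ⟨f, u, hs, ht⟩ := geometric_hahn_banach_open hKconv hKopen hS hdisj
  have hfA := ht A hA.1
  obtain ⟨N, hN⟩ := exists_matDot_eq (-f)
  have hpos : ∀ y ∈ interior (basisCone B), 0 < matDot N y := by
    intro y hy
    have := hs (A + y) ((hint y).2 hy)
    rw [map_add] at this
    rw [← hN, _root_.neg_apply]
    linarith
  obtain ⟨t, ht0, htB⟩ := exists_smul_mem_of_forall_interior_pos hB hpos
  refine ⟨t • N, htB, fun A' hA' => ?_⟩
  rw [smul_matDot, smul_matDot]
  refine mul_le_mul_of_nonneg_left ?_ ht0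
  rw [← hN, ← hN, _root_.neg_apply, _root_.neg_apply, neg_le_neg_iff]
  refine le_trans ?_ (ht A' hA')
  -- What remains is `f A ≤ u`: it holds because `A` is a limit of points `A + r • y` with `y`
  -- interior, where `f < u`.
  by_contra! hlt
  obtain ⟨y, hy⟩ : (interior (basisCone B)).Nonempty := by
    by_contra hempty
    rw [Set.not_nonempty_iff_eq_empty] at hempty
    -- Were the interior empty, `N = 0` would satisfy the positivity condition vacuously and put `0`
    -- in `B`.
    obtain ⟨r, -, hr⟩ := exists_smul_mem_of_forall_interior_pos hB (N := 0) (by simp [hempty])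
    exact hB.zero_notMem (by simpa using hr)
  have hc : Filter.Tendsto (fun r : ℝ => f (A + r • y)) (nhdsWithin 0 (Set.Ioi 0))
      (nhds (f A)) := by
    have : Continuous fun r : ℝ => f (A + r • y) := by fun_prop
    simpa using (this.tendsto 0).mono_left nhdsWithin_le_nhds
  obtain ⟨r, hr, hr0⟩ := ((hc.eventually (lt_mem_nhds hlt)).and self_mem_nhdsWithin).exists
  refine lt_asymm hr (hs _ ((hint _).2 ?_))
  rw [mem_interior_basisCone hB] at hy ⊢
  intro x hx
  rw [matDot_smul]
  exact mul_pos hr0 (hy x hx)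

theorem isConicMaximal_iff {B S : Set (Matrix I J ℝ)} (hB : IsCompactBasis B)
    (hS : Convex ℝ S) {A : Matrix I J ℝ} (hA : A ∈ S) :
    IsConicMaximal B S A ↔ ∃ M ∈ B, ∀ A' ∈ S, matDot M A' ≤ matDot M A := by
  refine ⟨fun h => h.exists_forall_matDot_le hB hS, fun ⟨M, hM, h⟩ => ⟨hA, fun A' hA' hgt => ?_⟩⟩
  have h1 := (mem_interior_basisCone hB).1 hgt M hM
  rw [matDot_sub] at h1
  linarith [h A' hA']

/-- From an interior point, a small move in the direction `M` stays in `S` and increases the form.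
-/
theorem notMem_interior_of_forall_matDot_le {S : Set (Matrix I J ℝ)} {A M : Matrix I J ℝ}
    (hM : M ≠ 0) (h : ∀ A' ∈ S, matDot M A' ≤ matDot M A) : A ∉ interior S := by
  intro hA
  have hc : Filter.Tendsto (fun t : ℝ => A + t • M) (nhdsWithin 0 (Set.Ioi 0)) (nhds A) := by
    have : Continuous fun t : ℝ => A + t • M := by fun_prop
    simpa using (this.tendsto 0).mono_left nhdsWithin_le_nhds
  obtain ⟨t, ht, ht0⟩ :=
    ((hc.eventually (mem_interior_iff_mem_nhds.1 hA)).and self_mem_nhdsWithin).exists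
  have h1 := h _ ht
  rw [matDot_add, matDot_smul] at h1
  linarith [mul_pos (Set.mem_Ioi.1 ht0) (matDot_self_pos hM)]

end Conic

/-! ### Optimality from a dual certificate. -/

section Transport

/-- Weak duality. The potentials `f`, `g` are not assumed integrable; their integrable minorants
`l`, `m` supply this. -/
theorem integral_le_integral_of_dual {X Y : Type*} [MeasurableSpace X] [MeasurableSpace Y]
    {π π' : Measure (X × Y)} (hfst : π'.fst = π.fst) (hsnd : π'.snd = π.snd)
    {c : X × Y → ℝ} (hc : Integrable c π) (hc' : Integrable c π')
    {f l : X → ℝ} {g m : Y → ℝ} (hf : Measurable f) (hg : Measurable g)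
    (hl : Integrable l π.fst) (hm : Integrable m π.snd)
    {A : Set X} {D : Set Y} (hA : MeasurableSet A) (hD : MeasurableSet D)
    (hlf : ∀ x ∈ A, l x ≤ f x) (hmg : ∀ y ∈ D, m y ≤ g y)
    (hle : ∀ x ∈ A, ∀ y ∈ D, c (x, y) ≤ f x + g y)
    (hae : ∀ᵐ z ∂π, z.1 ∈ A ∧ z.2 ∈ D ∧ f z.1 + g z.2 = c z) :
    ∫ z, c z ∂π' ≤ ∫ z, c z ∂π := by
  have hPA : ∀ᵐ x ∂π.fst, x ∈ A :=
    (ae_map_iff measurable_fst.aemeasurable hA).2 (hae.mono fun z hz => hz.1)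
  have hQD : ∀ᵐ y ∂π.snd, y ∈ D :=
    (ae_map_iff measurable_snd.aemeasurable hD).2 (hae.mono fun z hz => hz.2.1)
  have hl1 : Integrable (fun z : X × Y => l z.1) π := hl.comp_measurable measurable_fst
  have hm1 : Integrable (fun z : X × Y => m z.2) π := hm.comp_measurable measurable_snd
  -- Almost surely `0 ≤ f - l ≤ c - l - m`, because `c = f + g` and `g ≥ m`.
  have hfl : Integrable (fun z : X × Y => f z.1 - l z.1) π := by
    refine ((hc.sub hl1).sub hm1).mono'
      ((hf.comp measurable_fst).aestronglyMeasurable.sub hl1.aestronglyMeasurable) ?_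
    filter_upwards [hae] with z ⟨h1, h2, h3⟩
    have h4 := hlf _ h1
    have h5 := hmg _ h2
    rw [Real.norm_of_nonneg (by linarith)]
    simp only [Pi.sub_apply]
    linarith
  have hf1 : Integrable (fun z : X × Y => f z.1) π :=
    (hfl.add hl1).congr (.of_forall fun z => by simp)
  have hg1 : Integrable (fun z : X × Y => g z.2) π :=
    (hc.sub hf1).congr (hae.mono fun z hz => by
      simp only [Pi.sub_apply]
      linarith [hz.2.2])
  have hfP : Integrable f π.fst :=
    (integrable_map_measure hf.aestronglyMeasurable measurable_fst.aemeasurable).2 hf1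
  have hgQ : Integrable g π.snd :=
    (integrable_map_measure hg.aestronglyMeasurable measurable_snd.aemeasurable).2 hg1
  have hf2 : Integrable (fun z : X × Y => f z.1) π' :=
    (hfst ▸ hfP : Integrable f π'.fst).comp_measurable measurable_fst
  have hg2 : Integrable (fun z : X × Y => g z.2) π' :=
    (hsnd ▸ hgQ : Integrable g π'.snd).comp_measurable measurable_snd
  have hA' : ∀ᵐ z ∂π', z.1 ∈ A :=
    ae_of_ae_map measurable_fst.aemeasurable (hfst ▸ hPA : ∀ᵐ x ∂π'.fst, x ∈ A)
  have hD' : ∀ᵐ z ∂π', z.2 ∈ D :=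
    ae_of_ae_map measurable_snd.aemeasurable (hsnd ▸ hQD : ∀ᵐ y ∂π'.snd, y ∈ D)
  have hfint : ∀ μ : Measure (X × Y), ∫ z, f z.1 ∂μ = ∫ x, f x ∂μ.fst := fun μ =>
    (integral_map measurable_fst.aemeasurable hf.aestronglyMeasurable).symm
  have hgint : ∀ μ : Measure (X × Y), ∫ z, g z.2 ∂μ = ∫ y, g y ∂μ.snd := fun μ =>
    (integral_map measurable_snd.aemeasurable hg.aestronglyMeasurable).symm
  calc ∫ z, c z ∂π' ≤ ∫ z, f z.1 + g z.2 ∂π' := by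
        refine integral_mono_ae hc' (hf2.add hg2) ?_
        filter_upwards [hA', hD'] with z h1 h2 using hle _ h1 _ h2
    _ = ∫ z, f z.1 + g z.2 ∂π := by
        rw [integral_add hf2 hg2, integral_add hf1 hg1, hfint, hgint, hfint, hgint, hfst, hsnd]
    _ = ∫ z, c z ∂π := integral_congr_ae (hae.mono fun z hz => hz.2.2)

end Transport

/-! ### Convex conjugates and the Fenchel–Young inequality. -/

section Conjugate

variable {I : Type*} [Fintype I]

/-- The convex conjugate `u*(w) = sup_x (w · x - u(x))`. -/
noncomputable def convexConjugate (u : (I → ℝ) → EReal) (w : I → ℝ) : EReal :=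
  ⨆ x, ((w ⬝ᵥ x : ℝ) : EReal) - u x

/-- A supremum of continuous functions is lower semicontinuous, so no regularity of `u` is needed.
-/
theorem measurable_convexConjugate (u : (I → ℝ) → EReal) : Measurable (convexConjugate u) := by
  refine LowerSemicontinuous.measurable (lowerSemicontinuous_iSup fun x => ?_)
  refine Continuous.lowerSemicontinuous ?_
  induction u x with
  | bot => simpa using continuous_const
  | top => simpa using continuous_const
  | coe r =>
    simp only [← EReal.coe_sub]
    exact continuous_coe_real_ereal.comp (by fun_prop)

theorem convexConjugate_of_mem_subdiff {u : (I → ℝ) → EReal} {x w : I → ℝ}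
    (h : w ∈ subdiff u x) :
    convexConjugate u w = ((w ⬝ᵥ x - (u x).toReal : ℝ) : EReal) := by
  obtain ⟨h1, h2, h3⟩ := h
  refine le_antisymm (iSup_le fun y => ?_) ?_
  · have h4 := h3 y
    rw [← EReal.coe_toReal h1 h2, ← EReal.coe_add] at h4
    generalize u y = s at h4 ⊢
    induction s with
    | bot => exact absurd (le_bot_iff.1 h4) (EReal.coe_ne_bot _)
    | top => simp
    | coe s =>
      rw [EReal.coe_le_coe_iff, dotProduct_sub] at h4
      rw [← EReal.coe_sub, EReal.coe_le_coe_iff]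
      linarith
  · refine le_iSup_of_le x ?_
    rw [EReal.coe_sub, EReal.coe_toReal h1 h2]

/-- This lets the measurable function `u**` replace `u` on the graph of `∂u`. -/
theorem convexConjugate_convexConjugate_of_mem_subdiff {u : (I → ℝ) → EReal} {x w : I → ℝ}
    (h : w ∈ subdiff u x) :
    convexConjugate (convexConjugate u) x = (((u x).toReal : ℝ) : EReal) := by
  have hw := convexConjugate_of_mem_subdiff h
  obtain ⟨h1, h2, -⟩ := h
  refine le_antisymm (iSup_le fun y => ?_) ?_
  · have h4 : ((y ⬝ᵥ x - (u x).toReal : ℝ) : EReal) ≤ convexConjugate u y := by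
      refine le_iSup_of_le x ?_
      rw [EReal.coe_sub, EReal.coe_toReal h1 h2]
    refine (EReal.sub_le_sub le_rfl h4).trans ?_
    rw [← EReal.coe_sub, EReal.coe_le_coe_iff, dotProduct_comm]
    linarith
  · refine le_iSup_of_le w ?_
    rw [hw, ← EReal.coe_sub, EReal.coe_le_coe_iff, dotProduct_comm]
    linarith

theorem dotProduct_le_toReal_convexConjugate_add {v : (I → ℝ) → EReal} {x w : I → ℝ}
    (hx : convexConjugate v x ≠ ⊤ ∧ convexConjugate v x ≠ ⊥) (hw : v w ≠ ⊤ ∧ v w ≠ ⊥) :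
    x ⬝ᵥ w ≤ (convexConjugate v x).toReal + (v w).toReal := by
  have h : ((x ⬝ᵥ w : ℝ) : EReal) - v w ≤ convexConjugate v x :=
    le_iSup (fun w => ((x ⬝ᵥ w : ℝ) : EReal) - v w) w
  lift v w to ℝ using hw with r
  lift convexConjugate v x to ℝ using hx with s
  rw [← EReal.coe_sub, EReal.coe_le_coe_iff] at h
  simpa using sub_le_iff_le_add.1 h

end Conjugate

/-! ### The covariance set, and optimality of subdifferential couplings. -/

section Covariance

variable {I J : Type*} [Fintype I] [Fintype J] {P : Measure (I → ℝ)} {Q : Measure (J → ℝ)}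
  {π : Measure ((I → ℝ) × (J → ℝ))}

theorem integrable_mul_of_mem_couplings (hP : MemLp (fun x : I → ℝ => x) 2 P)
    (hQ : MemLp (fun y : J → ℝ => y) 2 Q) (hπ : π ∈ couplings P Q) (i : I) (j : J) :
    Integrable (fun z : (I → ℝ) × (J → ℝ) => z.1 i * z.2 j) π := by
  obtain ⟨rfl, rfl⟩ := hπ
  have h1 : MemLp (fun z : (I → ℝ) × (J → ℝ) => z.1 i) 2 π :=
    (memLp_pi_iff.1 hP i).comp_of_map measurable_fst.aemeasurable
  have h2 : MemLp (fun z : (I → ℝ) × (J → ℝ) => z.2 j) 2 π :=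
    (memLp_pi_iff.1 hQ j).comp_of_map measurable_snd.aemeasurable
  exact h1.integrable_mul h2

theorem dotProduct_mulVec_eq_sum (M : Matrix I J ℝ) (x : I → ℝ) (y : J → ℝ) :
    x ⬝ᵥ (M *ᵥ y) = ∑ i, ∑ j, M i j * (x i * y j) := by
  simp only [dotProduct, mulVec, Finset.mul_sum]
  exact Finset.sum_congr rfl fun i _ => Finset.sum_congr rfl fun j _ => by ring

theorem integrable_dotProduct_mulVec (hP : MemLp (fun x : I → ℝ => x) 2 P)
    (hQ : MemLp (fun y : J → ℝ => y) 2 Q) (hπ : π ∈ couplings P Q) (M : Matrix I J ℝ) :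
    Integrable (fun z : (I → ℝ) × (J → ℝ) => z.1 ⬝ᵥ (M *ᵥ z.2)) π := by
  simp only [dotProduct_mulVec_eq_sum]
  exact integrable_finsetSum _ fun i _ => integrable_finsetSum _ fun j _ =>
    (integrable_mul_of_mem_couplings hP hQ hπ i j).const_mul _

theorem matDot_crossCov (hP : MemLp (fun x : I → ℝ => x) 2 P)
    (hQ : MemLp (fun y : J → ℝ => y) 2 Q) (hπ : π ∈ couplings P Q) (M : Matrix I J ℝ) :
    matDot M (crossCov π) = ∫ z, z.1 ⬝ᵥ (M *ᵥ z.2) ∂π := by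
  have hint := integrable_mul_of_mem_couplings hP hQ hπ
  simp only [dotProduct_mulVec_eq_sum, matDot_eq_sum, crossCov, Matrix.of_apply]
  symm
  refine (integral_finsetSum _ fun i _ => integrable_finsetSum _ fun j _ =>
    (hint i j).const_mul _).trans (Finset.sum_congr rfl fun i _ => ?_)
  refine (integral_finsetSum _ fun j _ => (hint i j).const_mul _).trans
    (Finset.sum_congr rfl fun j _ => integral_const_mul _ _)

omit [Fintype I] [Fintype J] in
theorem covarianceSet_eq_image (P : Measure (I → ℝ)) (Q : Measure (J → ℝ)) :
    covarianceSet P Q = crossCov '' couplings P Q := by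
  ext S
  constructor
  · rintro ⟨π, hπ, h⟩
    exact ⟨π, hπ, Matrix.ext fun i j => (h i j).symm⟩
  · rintro ⟨π, hπ, rfl⟩
    exact ⟨π, hπ, fun i j => rfl⟩

omit [Fintype I] [Fintype J] in
theorem smul_add_smul_mem_couplings {π₁ π₂ : Measure ((I → ℝ) × (J → ℝ))}
    (h₁ : π₁ ∈ couplings P Q) (h₂ : π₂ ∈ couplings P Q) {a b : ENNReal} (hab : a + b = 1) :
    a • π₁ + b • π₂ ∈ couplings P Q := by
  obtain ⟨h1, h1'⟩ := h₁
  obtain ⟨h2, h2'⟩ := h₂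
  constructor
  · rw [Measure.fst, Measure.map_add _ _ measurable_fst, Measure.map_smul, Measure.map_smul]
    change a • π₁.fst + b • π₂.fst = P
    rw [h1, h2, ← add_smul, hab, one_smul]
  · rw [Measure.snd, Measure.map_add _ _ measurable_snd, Measure.map_smul, Measure.map_smul]
    change a • π₁.snd + b • π₂.snd = Q
    rw [h1', h2', ← add_smul, hab, one_smul]

theorem convex_covarianceSet (hP : MemLp (fun x : I → ℝ => x) 2 P)
    (hQ : MemLp (fun y : J → ℝ => y) 2 Q) : Convex ℝ (covarianceSet P Q) := by
  rw [covarianceSet_eq_image]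
  rintro _ ⟨π₁, h₁, rfl⟩ _ ⟨π₂, h₂, rfl⟩ a b ha hb hab
  refine ⟨ENNReal.ofReal a • π₁ + ENNReal.ofReal b • π₂,
    smul_add_smul_mem_couplings h₁ h₂ (by rw [← ENNReal.ofReal_add ha hb, hab]; simp), ?_⟩
  ext i j
  simp only [crossCov, Matrix.of_apply, Matrix.add_apply, Matrix.smul_apply]
  rw [integral_add_measure
    ((integrable_mul_of_mem_couplings hP hQ h₁ i j).smul_measure ENNReal.ofReal_ne_top)
    ((integrable_mul_of_mem_couplings hP hQ h₂ i j).smul_measure ENNReal.ofReal_ne_top),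
    integral_smul_measure, integral_smul_measure, ENNReal.toReal_ofReal ha,
    ENNReal.toReal_ofReal hb]

/-- A coupling concentrated on the graph of a subdifferential maximises the expectation of
`X' M Y`. -/
theorem integral_le_of_ae_mem_subdiff [IsProbabilityMeasure P] [IsProbabilityMeasure Q]
    (hP : MemLp (fun x : I → ℝ => x) 2 P)
    (hQ : MemLp (fun y : J → ℝ => y) 2 Q) (hπ : π ∈ couplings P Q) {M : Matrix I J ℝ}
    {u : (I → ℝ) → EReal} (hu : ∀ᵐ z ∂π, M *ᵥ z.2 ∈ subdiff u z.1)
    {π' : Measure ((I → ℝ) × (J → ℝ))} (hπ' : π' ∈ couplings P Q) :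
    ∫ z, z.1 ⬝ᵥ (M *ᵥ z.2) ∂π' ≤ ∫ z, z.1 ⬝ᵥ (M *ᵥ z.2) ∂π := by
  have hπne : NeZero π := ⟨by
    rintro rfl
    apply IsProbabilityMeasure.ne_zero P
    rw [← hπ.1, Measure.fst_zero]⟩
  -- Fenchel–Young against this single point of the graph provides affine, hence integrable,
  -- minorants of both potentials.
  obtain ⟨z₀, hz₀⟩ := hu.exists
  have hPi : Integrable (fun x : I → ℝ => x) P := hP.integrable one_le_two
  have hQi : Integrable (fun y : J → ℝ => y) Q := hQ.integrable one_le_two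
  have hPc : ∀ i, Integrable (fun x : I → ℝ => x i) P := fun i => hPi.eval i
  have hQc : ∀ j, Integrable (fun y : J → ℝ => y j) Q := fun j => hQi.eval j
  have hφm := measurable_convexConjugate (convexConjugate u)
  have hψm : Measurable fun y : J → ℝ => convexConjugate u (M *ᵥ y) :=
    (measurable_convexConjugate u).comp (by fun_prop : Continuous fun y => M *ᵥ y).measurable
  have hfin : MeasurableSet {a : EReal | a ≠ ⊤ ∧ a ≠ ⊥} :=
    (measurableSet_singleton ⊤).compl.inter (measurableSet_singleton ⊥).compl
  have hx₀ := convexConjugate_convexConjugate_of_mem_subdiff hz₀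
  have hw₀ := convexConjugate_of_mem_subdiff hz₀
  refine integral_le_integral_of_dual (hπ'.1.trans hπ.1.symm) (hπ'.2.trans hπ.2.symm)
    (integrable_dotProduct_mulVec hP hQ hπ M) (integrable_dotProduct_mulVec hP hQ hπ' M)
    (f := fun x => (convexConjugate (convexConjugate u) x).toReal)
    (g := fun y => (convexConjugate u (M *ᵥ y)).toReal)
    (l := fun x => x ⬝ᵥ (M *ᵥ z₀.2) - (convexConjugate u (M *ᵥ z₀.2)).toReal)
    (m := fun y => z₀.1 ⬝ᵥ (M *ᵥ y) - (convexConjugate (convexConjugate u) z₀.1).toReal)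
    hφm.ereal_toReal hψm.ereal_toReal ?_ ?_ (hφm hfin) (hψm hfin) ?_ ?_ ?_ ?_
  · rw [hπ.1]
    refine Integrable.sub ?_ (integrable_const _)
    exact integrable_finsetSum _ fun i _ => (hPc i).mul_const _
  · rw [hπ.2]
    refine Integrable.sub ?_ (integrable_const _)
    simp only [dotProduct_mulVec_eq_sum]
    exact integrable_finsetSum _ fun i _ => integrable_finsetSum _ fun j _ =>
      ((hQc j).const_mul _).const_mul _
  · intro x hx
    exact sub_le_iff_le_add.2 (dotProduct_le_toReal_convexConjugate_add hx
      (by rw [hw₀]; exact ⟨EReal.coe_ne_top _, EReal.coe_ne_bot _⟩))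
  · intro y hy
    exact sub_le_iff_le_add'.2 (dotProduct_le_toReal_convexConjugate_add
      (by rw [hx₀]; exact ⟨EReal.coe_ne_top _, EReal.coe_ne_bot _⟩) hy)
  · intro x hx y hy
    exact dotProduct_le_toReal_convexConjugate_add hx hy
  · filter_upwards [hu] with z hz
    have hx := convexConjugate_convexConjugate_of_mem_subdiff hz
    have hw := convexConjugate_of_mem_subdiff hz
    refine ⟨?_, ?_, ?_⟩
    · simp only [Set.mem_preimage, hx]
      exact ⟨EReal.coe_ne_top _, EReal.coe_ne_bot _⟩
    · simp only [Set.mem_preimage, hw]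
      exact ⟨EReal.coe_ne_top _, EReal.coe_ne_bot _⟩
    · simp only [hx, hw, EReal.toReal_coe, dotProduct_comm (M *ᵥ z.2)]
      ring

end Covariance

/-! ### Cyclic monotonicity of optimal plans. -/

section CyclicMonotonicity

open ProbabilityTheory

theorem fst_smul_sum {X Y ι : Type*} [MeasurableSpace X] [MeasurableSpace Y] [Fintype ι]
    (k : ENNReal) (μ : ι → Measure (X × Y)) : (k • ∑ i, μ i).fst = k • ∑ i, (μ i).fst := by
  rw [Measure.fst, Measure.map_smul, ← Measure.mapₗ_apply_of_measurable measurable_fst, map_sum]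
  simp only [Measure.mapₗ_apply_of_measurable measurable_fst, Measure.fst]

theorem snd_smul_sum {X Y ι : Type*} [MeasurableSpace X] [MeasurableSpace Y] [Fintype ι]
    (k : ENNReal) (μ : ι → Measure (X × Y)) : (k • ∑ i, μ i).snd = k • ∑ i, (μ i).snd := by
  rw [Measure.snd, Measure.map_smul, ← Measure.mapₗ_apply_of_measurable measurable_snd, map_sum]
  simp only [Measure.mapₗ_apply_of_measurable measurable_snd, Measure.snd]

/-- Exchanging the second coordinates of finitely many pieces of mass `k` of an optimal transport
plan does not improve it. -/
theorem sum_integral_prod_le {X Y ι : Type*} [MeasurableSpace X] [MeasurableSpace Y] [Fintype ι]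
    {π : Measure (X × Y)} {c : X × Y → ℝ} (hc : Integrable c π)
    (hopt : ∀ π' : Measure (X × Y), π'.fst = π.fst → π'.snd = π.snd →
      Integrable c π' ∧ ∫ z, c z ∂π' ≤ ∫ z, c z ∂π)
    (μ : ι → Measure (X × Y)) [∀ i, IsProbabilityMeasure (μ i)] {k : ENNReal} (hk0 : k ≠ 0)
    (hk : k ≠ ⊤) (hle : k • ∑ i, μ i ≤ π) (σ : Equiv.Perm ι) :
    (∀ i, Integrable c ((μ (σ i)).fst.prod (μ i).snd)) ∧
      ∑ i, ∫ z, c z ∂((μ (σ i)).fst.prod (μ i).snd) ≤ ∑ i, ∫ z, c z ∂(μ i) := by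
  set ρ := k • ∑ i, μ i with hρ
  -- Replacing `ρ` by `ν` inside `π` keeps both marginals: `σ` only permutes the first marginals in
  -- the sum.
  set ν := k • ∑ i, (μ (σ i)).fst.prod (μ i).snd with hν
  have hρfin : IsFiniteMeasure ρ := Measure.smul_finite _ hk
  have hsplit : π - ρ + ρ = π := Measure.sub_add_cancel_of_le hle
  have hνfst : ν.fst = ρ.fst := by
    rw [hν, hρ, fst_smul_sum, fst_smul_sum]
    simp only [Measure.fst_prod]
    rw [Equiv.sum_comp σ fun i => (μ i).fst]
  have hνsnd : ν.snd = ρ.snd := by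
    rw [hν, hρ, snd_smul_sum, snd_smul_sum]
    simp only [Measure.snd_prod]
  obtain ⟨hint, hval⟩ := hopt (π - ρ + ν)
    (by rw [Measure.fst_add, hνfst, ← Measure.fst_add, hsplit])
    (by rw [Measure.snd_add, hνsnd, ← Measure.snd_add, hsplit])
  have h1 : Integrable c (π - ρ) := hc.mono_measure Measure.sub_le
  have h2 : Integrable c ρ := hc.mono_measure hle
  have h3 : Integrable c ν := hint.mono_measure (Measure.le_add_left le_rfl)
  have key : ∀ τ : ι → Measure (X × Y), Integrable c (k • ∑ i, τ i) →
      (∀ i, Integrable c (τ i)) ∧ ∫ z, c z ∂(k • ∑ i, τ i) = k.toReal * ∑ i, ∫ z, c z ∂(τ i) := by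
    intro τ hτ
    have h := (integrable_smul_measure hk0 hk).1 hτ
    have h' : ∀ i ∈ Finset.univ, Integrable c (τ i) := integrable_finsetSum_measure.1 h
    refine ⟨fun i => h' i (Finset.mem_univ i), ?_⟩
    rw [integral_smul_measure, integral_finsetSum_measure h', smul_eq_mul]
  have e1 := key _ h2
  have e2 := key _ h3
  refine ⟨e2.1, ?_⟩
  have e3 : ∫ z, c z ∂π = ∫ z, c z ∂(π - ρ) + ∫ z, c z ∂ρ := by
    conv_lhs => rw [← hsplit]
    exact integral_add_measure h1 h2
  rw [integral_add_measure h1 h3, e3, hρ, hν, e1.2, e2.2] at hval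
  exact le_of_mul_le_mul_left (le_of_add_le_add_left hval) (ENNReal.toReal_pos hk0 hk)

/-- The support of an optimal transport plan is cyclically monotone. -/
theorem sum_le_sum_of_mem_support {X Y ι : Type*} [TopologicalSpace X] [TopologicalSpace Y]
    [SecondCountableTopology X] [SecondCountableTopology Y] [MeasurableSpace X]
    [MeasurableSpace Y] [BorelSpace X] [BorelSpace Y] [Fintype ι]
    {π : Measure (X × Y)} [IsProbabilityMeasure π] {c : X × Y → ℝ} (hcont : Continuous c)
    (hc : Integrable c π)
    (hopt : ∀ π' : Measure (X × Y), π'.fst = π.fst → π'.snd = π.snd →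
      Integrable c π' ∧ ∫ z, c z ∂π' ≤ ∫ z, c z ∂π)
    {z : ι → X × Y} (hz : ∀ i, z i ∈ π.support) (σ : Equiv.Perm ι) :
    ∑ i, c ((z (σ i)).1, (z i).2) ≤ ∑ i, c (z i) := by
  rcases isEmpty_or_nonempty ι with hι | hι
  · simp
  refine le_of_forall_pos_le_add fun η hη => ?_
  have hn : (0 : ℝ) < Fintype.card ι := by exact_mod_cast Fintype.card_pos
  set δ : ℝ := η / (2 * Fintype.card ι) with hδ
  have hδ0 : 0 < δ := by positivity
  have hnhds : ∀ i j, ∃ U : Set X, ∃ V : Set Y, IsOpen U ∧ IsOpen V ∧ (z i).1 ∈ U ∧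
      (z j).2 ∈ V ∧ ∀ p ∈ U ×ˢ V, |c p - c ((z i).1, (z j).2)| < δ := by
    intro i j
    have hopen : IsOpen {p | |c p - c ((z i).1, (z j).2)| < δ} :=
      isOpen_lt (by fun_prop) continuous_const
    obtain ⟨U, V, hU, hV, h1, h2, h3⟩ := isOpen_prod_iff.1 hopen (z i).1 (z j).2 (by simpa)
    exact ⟨U, V, hU, hV, h1, h2, h3⟩
  choose U V hU hV hzU hzV hUV using hnhds
  -- Intersecting over `j` makes one neighbourhood of `z i` serve for every pairing of its two
  -- coordinates.
  set A : ι → Set (X × Y) := fun i => (⋂ j, U i j) ×ˢ (⋂ j, V j i) with hA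
  have hAopen : ∀ i, IsOpen (A i) := fun i =>
    (isOpen_iInter_of_finite fun j => hU i j).prod (isOpen_iInter_of_finite fun j => hV j i)
  have hApos : ∀ i, 0 < π (A i) := fun i =>
    (Measure.mem_support_iff_forall _).1 (hz i) _ ((hAopen i).mem_nhds
      ⟨Set.mem_iInter.2 fun j => hzU i j, Set.mem_iInter.2 fun j => hzV j i⟩)
  -- The smallest mass fits under every `A i`; dividing it by the number of pieces keeps their sum
  -- below `π` even when the `A i` overlap.
  obtain ⟨i₀, hi₀⟩ := Finite.exists_min fun i => π (A i)
  have hprob : ∀ i, IsProbabilityMeasure π[|A i] := fun i =>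
    cond_isProbabilityMeasure (hApos i).ne'
  have hk0 : (Fintype.card ι : ENNReal)⁻¹ * π (A i₀) ≠ 0 :=
    mul_ne_zero (ENNReal.inv_ne_zero.2 (ENNReal.natCast_ne_top _)) (hApos i₀).ne'
  have hcard : (Fintype.card ι : ENNReal) ≠ 0 := by exact_mod_cast Fintype.card_ne_zero
  have hk : (Fintype.card ι : ENNReal)⁻¹ * π (A i₀) ≠ ⊤ :=
    ENNReal.mul_ne_top (ENNReal.inv_ne_top.2 hcard) (measure_ne_top _ _)
  have hle : ((Fintype.card ι : ENNReal)⁻¹ * π (A i₀)) • ∑ i, π[|A i] ≤ π := by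
    have h1 : ∀ i, π (A i₀) • π[|A i] ≤ π := by
      intro i
      rw [ProbabilityTheory.cond, smul_smul]
      have h2 : π (A i₀) * (π (A i))⁻¹ ≤ 1 :=
        (mul_le_mul_left (hi₀ i) _).trans (ENNReal.mul_inv_le_one _)
      refine Measure.le_intro fun s _ _ => ?_
      rw [Measure.smul_apply, smul_eq_mul]
      exact (mul_le_mul' h2 (Measure.restrict_le_self s)).trans_eq (one_mul _)
    rw [mul_smul, Finset.smul_sum]
    refine Measure.le_intro fun s _ _ => ?_
    rw [Measure.smul_apply, Measure.finsetSum_apply, smul_eq_mul]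
    calc _ ≤ (Fintype.card ι : ENNReal)⁻¹ * ∑ _i : ι, π s :=
          mul_le_mul_right (Finset.sum_le_sum fun i _ => h1 i s) _
      _ = π s := by
          rw [Finset.sum_const, Finset.card_univ, nsmul_eq_mul, ← mul_assoc,
            ENNReal.inv_mul_cancel hcard (ENNReal.natCast_ne_top _), one_mul]
  obtain ⟨hint, hsum⟩ := sum_integral_prod_le hc hopt (fun i => π[|A i]) hk0 hk hle σ
  have haeA : ∀ i, ∀ᵐ p ∂π[|A i], p ∈ A i := fun i =>
    Measure.ae_smul_measure (ae_restrict_mem (hAopen i).measurableSet) _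
  have hfst : ∀ i, ∀ᵐ x ∂(π[|A i]).fst, x ∈ ⋂ j, U i j := fun i =>
    (ae_map_iff measurable_fst.aemeasurable
      (isOpen_iInter_of_finite fun j => hU i j).measurableSet).2 ((haeA i).mono fun p hp => hp.1)
  have hsnd : ∀ i, ∀ᵐ y ∂(π[|A i]).snd, y ∈ ⋂ j, V j i := fun i =>
    (ae_map_iff measurable_snd.aemeasurable
      (isOpen_iInter_of_finite fun j => hV j i).measurableSet).2 ((haeA i).mono fun p hp => hp.2)
  have hlow : ∀ i, c ((z (σ i)).1, (z i).2) - δ ≤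
      ∫ p, c p ∂((π[|A (σ i)]).fst.prod (π[|A i]).snd) := by
    intro i
    have hae : ∀ᵐ p ∂((π[|A (σ i)]).fst.prod (π[|A i]).snd),
        c ((z (σ i)).1, (z i).2) - δ ≤ c p := by
      filter_upwards [Measure.quasiMeasurePreserving_fst.ae (hfst (σ i)),
        Measure.quasiMeasurePreserving_snd.ae (hsnd i)] with p h1 h2
      have := abs_lt.1 (hUV (σ i) i p ⟨Set.mem_iInter.1 h1 i, Set.mem_iInter.1 h2 (σ i)⟩)
      linarith
    simpa using integral_mono_ae (integrable_const _) (hint i) hae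
  have hup : ∀ i, ∫ p, c p ∂π[|A i] ≤ c (z i) + δ := by
    intro i
    have hae : ∀ᵐ p ∂π[|A i], c p ≤ c (z i) + δ := by
      filter_upwards [haeA i] with p hp
      have := abs_lt.1 (hUV i i p ⟨Set.mem_iInter.1 hp.1 i, Set.mem_iInter.1 hp.2 i⟩)
      linarith
    have hci : Integrable c π[|A i] :=
      hc.restrict.smul_measure (ENNReal.inv_ne_top.2 (hApos i).ne')
    simpa using integral_mono_ae hci (integrable_const _) hae
  have h1 := Finset.sum_le_sum fun i (_ : i ∈ Finset.univ) => hlow i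
  have h2 := Finset.sum_le_sum fun i (_ : i ∈ Finset.univ) => hup i
  simp only [Finset.sum_sub_distrib, Finset.sum_add_distrib, Finset.sum_const, Finset.card_univ,
    nsmul_eq_mul] at h1 h2
  have h3 : (Fintype.card ι : ℝ) * δ = η / 2 := by
    rw [hδ]
    field_simp
  linarith

end CyclicMonotonicity

/-! ### Rockafellar's convex potential. -/

section Rockafellar

variable {I : Type*} [Fintype I]

/-- The value at `x` of the affine function that a chain `p 0, …, p m` of points and slopes
defines. -/
def chainValue (m : ℕ) (p : ℕ → (I → ℝ) × (I → ℝ)) (x : I → ℝ) : ℝ :=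
  ∑ i ∈ Finset.range m, (p i).2 ⬝ᵥ ((p (i + 1)).1 - (p i).1) + (p m).2 ⬝ᵥ (x - (p m).1)

theorem chainValue_congr {m : ℕ} {p q : ℕ → (I → ℝ) × (I → ℝ)} (h : ∀ i ≤ m, p i = q i)
    (x : I → ℝ) : chainValue m p x = chainValue m q x := by
  unfold chainValue
  rw [h m le_rfl]
  congr 1
  refine Finset.sum_congr rfl fun i hi => ?_
  have hi' := Finset.mem_range.1 hi
  rw [h i hi'.le, h (i + 1) hi']

theorem chainValue_succ (m : ℕ) (p : ℕ → (I → ℝ) × (I → ℝ)) (x : I → ℝ) :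
    chainValue (m + 1) p x =
      chainValue m p (p (m + 1)).1 + (p (m + 1)).2 ⬝ᵥ (x - (p (m + 1)).1) := by
  rw [chainValue, Finset.sum_range_succ, chainValue]

/-- Rockafellar's theorem: a cyclically monotone set lies in the graph of the subdifferential of
a proper convex function. -/
theorem exists_isProperConvex_of_cyclicallyMonotone {G : Set ((I → ℝ) × (I → ℝ))}
    (hne : G.Nonempty)
    (hG : ∀ m p, (∀ i, p i ∈ G) → chainValue m p (p 0).1 ≤ 0) :
    ∃ u : (I → ℝ) → EReal, IsProperConvex u ∧ ∀ z ∈ G, z.2 ∈ subdiff u z.1 := by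
  obtain ⟨z₀, hz₀⟩ := hne
  -- Chains of length `m` are infinite sequences of which only the entries `0, …, m` count; all
  -- start at `z₀`, so cyclic monotonicity bounds `u z₀.1` by `0`.
  let C := {q : ℕ × (ℕ → (I → ℝ) × (I → ℝ)) // (∀ i, q.2 i ∈ G) ∧ q.2 0 = z₀}
  let u : (I → ℝ) → EReal := fun x => ⨆ q : C, (chainValue q.1.1 q.1.2 x : EReal)
  have hle : ∀ (q : C) x, (chainValue q.1.1 q.1.2 x : EReal) ≤ u x := fun q x =>
    le_iSup (fun q : C => (chainValue q.1.1 q.1.2 x : EReal)) q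
  let q₀ : C := ⟨(0, fun _ => z₀), fun _ => hz₀, rfl⟩
  have hbot : ∀ x, u x ≠ ⊥ := fun x h =>
    EReal.coe_ne_bot _ (le_bot_iff.1 ((hle q₀ x).trans_eq h))
  have hu₀ : u z₀.1 ≤ 0 := iSup_le fun q => by
    have h := hG q.1.1 q.1.2 q.2.1
    rw [q.2.2] at h
    exact_mod_cast h
  -- Appending `z` to a chain gives another chain. This yields the subgradient inequality and, at `x
  -- = z₀.1`, finiteness of `u` at `z.1`.
  have hext : ∀ z ∈ G, ∀ (q : C) x,
      ((chainValue q.1.1 q.1.2 z.1 + z.2 ⬝ᵥ (x - z.1) : ℝ) : EReal) ≤ u x := by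
    intro z hz q x
    obtain ⟨⟨m, p⟩, hp, hp0⟩ := q
    have hp' : ∀ i, Function.update p (m + 1) z i ∈ G := fun i => by
      rcases eq_or_ne i (m + 1) with rfl | hi
      · simpa using hz
      · rw [Function.update_of_ne hi]
        exact hp i
    have hupd : ∀ i ≤ m, Function.update p (m + 1) z i = p i := fun i hi =>
      Function.update_of_ne (by omega) _ _
    refine le_trans (le_of_eq ?_) (hle ⟨(m + 1, Function.update p (m + 1) z), hp', ?_⟩ x)
    · dsimp only
      rw [chainValue_succ, Function.update_self, chainValue_congr hupd]
    · simpa using hp0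
  have htop : ∀ z ∈ G, u z.1 ≠ ⊤ := by
    intro z hz h
    have h1 : u z.1 ≤ ((-(z.2 ⬝ᵥ (z₀.1 - z.1)) : ℝ) : EReal) := iSup_le fun q => by
      have h2 := (hext z hz q z₀.1).trans hu₀
      rw [EReal.coe_le_coe_iff]
      have h3 : chainValue q.1.1 q.1.2 z.1 + z.2 ⬝ᵥ (z₀.1 - z.1) ≤ 0 := by exact_mod_cast h2
      linarith
    rw [h] at h1
    exact EReal.coe_ne_top _ (top_le_iff.1 h1)
  refine ⟨u, ⟨hbot, ⟨z₀.1, htop z₀ hz₀⟩, ?_⟩, fun z hz => ⟨htop z hz, hbot _, fun x => ?_⟩⟩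
  · have hepi : {p : (I → ℝ) × ℝ | u p.1 ≤ (p.2 : EReal)} =
        ⋂ q : C, {p | chainValue q.1.1 q.1.2 p.1 ≤ p.2} := by
      ext p
      simp [u, iSup_le_iff]
    rw [hepi]
    refine convex_iInter fun q => ?_
    intro x hx y hy a b ha hb hab
    simp only [Set.mem_ofPred_eq, chainValue, dotProduct_sub, Prod.fst_add, Prod.snd_add,
      Prod.smul_fst, Prod.smul_snd, dotProduct_add, dotProduct_smul, smul_eq_mul] at hx hy ⊢
    have h1 := mul_le_mul_of_nonneg_left hx ha
    have h2 := mul_le_mul_of_nonneg_left hy hb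
    obtain rfl : b = 1 - a := by linarith
    linarith
  · rw [← EReal.le_sub_iff_add_le (.inl (EReal.coe_ne_bot _)) (.inl (EReal.coe_ne_top _))]
    refine iSup_le fun q => ?_
    rw [EReal.le_sub_iff_add_le (.inl (EReal.coe_ne_bot _)) (.inl (EReal.coe_ne_top _)),
      ← EReal.coe_add]
    exact hext z hz q x

/-- Only the cyclic shift `i ↦ i + 1` is needed; its wrap-around at `m` is the term that closes the
chain. -/
theorem chainValue_nonpos_of_perm {m : ℕ} {p : ℕ → (I → ℝ) × (I → ℝ)}
    (h : ∀ σ : Equiv.Perm (Fin (m + 1)),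
      ∑ i, (p (σ i)).1 ⬝ᵥ (p i).2 ≤ ∑ i : Fin (m + 1), (p i).1 ⬝ᵥ (p i).2) :
    chainValue m p (p 0).1 ≤ 0 := by
  have h1 := h (finRotate (m + 1))
  rw [Fin.sum_univ_castSucc, Fin.sum_univ_castSucc, finRotate_last] at h1
  have h2 : ∀ i : Fin m, ((finRotate (m + 1) i.castSucc : Fin (m + 1)) : ℕ) = i + 1 := fun i => by
    rw [finRotate_apply, Fin.coeSucc_eq_succ, Fin.val_succ]
  simp only [h2, Fin.val_castSucc, Fin.val_last, Fin.val_zero] at h1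
  rw [Fin.sum_univ_eq_sum_range fun i => (p (i + 1)).1 ⬝ᵥ (p i).2,
    Fin.sum_univ_eq_sum_range fun i => (p i).1 ⬝ᵥ (p i).2] at h1
  simp only [chainValue, dotProduct_comm (p _).2, sub_dotProduct, Finset.sum_sub_distrib]
  linarith

end Rockafellar

/-! ### Assembly of the equivalences. -/

section MainTheorem

variable {I J : Type*} [Fintype I] [Fintype J] {P : Measure (I → ℝ)} {Q : Measure (J → ℝ)}
  {π : Measure ((I → ℝ) × (J → ℝ))}

/-- A coupling that maximises the expectation of `X' M Y` is concentrated on the graph of a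
subdifferential. -/
theorem exists_ae_mem_subdiff_of_forall_integral_le [IsProbabilityMeasure P]
    (hP : MemLp (fun x : I → ℝ => x) 2 P) (hQ : MemLp (fun y : J → ℝ => y) 2 Q)
    (hπ : π ∈ couplings P Q) {M : Matrix I J ℝ}
    (hmax : ∀ π' ∈ couplings P Q,
      ∫ z, z.1 ⬝ᵥ (M *ᵥ z.2) ∂π' ≤ ∫ z, z.1 ⬝ᵥ (M *ᵥ z.2) ∂π) :
    ∃ u : (I → ℝ) → EReal, IsProperConvex u ∧ ∀ᵐ z ∂π, M *ᵥ z.2 ∈ subdiff u z.1 := by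
  have hπp : IsProbabilityMeasure π := ⟨by
    rw [← Measure.fst_univ, hπ.1]
    exact measure_univ⟩
  obtain ⟨u, hu, hsub⟩ := exists_isProperConvex_of_cyclicallyMonotone
    (G := (fun z : (I → ℝ) × (J → ℝ) => (z.1, M *ᵥ z.2)) '' π.support)
    ((Measure.nonempty_support hπp.ne_zero).image _) (fun m p hp => by
      choose z hz hzp using hp
      refine chainValue_nonpos_of_perm fun σ => ?_
      simp only [← hzp]
      exact sum_le_sum_of_mem_support (c := fun z => z.1 ⬝ᵥ (M *ᵥ z.2)) (by fun_prop)
        (integrable_dotProduct_mulVec hP hQ hπ M)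
        (fun π' h1 h2 => by
          have hπ' : π' ∈ couplings P Q := ⟨h1.trans hπ.1, h2.trans hπ.2⟩
          exact ⟨integrable_dotProduct_mulVec hP hQ hπ' M, hmax π' hπ'⟩)
        (z := fun i : Fin (m + 1) => z i) (fun i => hz i) σ)
  refine ⟨u, hu, ?_⟩
  filter_upwards [Measure.support_mem_ae (μ := π)] with z hz
  exact hsub _ ⟨z, hz, rfl⟩

theorem isLUB_image_iff_of_mem {α β : Type*} [Preorder β] {f : α → β} {s : Set α} {a : α}
    (ha : a ∈ s) : IsLUB (f '' s) (f a) ↔ ∀ b ∈ s, f b ≤ f a :=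
  ⟨fun h b hb => h.1 ⟨b, hb, rfl⟩,
    fun h => ⟨Set.forall_mem_image.2 h, fun _ hu => hu ⟨a, ha, rfl⟩⟩⟩

end MainTheorem

theorem theorem2 {I J : Type*} [Fintype I] [Fintype J]
    (P : Measure (I → ℝ)) (Q : Measure (J → ℝ)) [IsProbabilityMeasure P] [IsProbabilityMeasure Q]
    (hP : MemLp (fun x : I → ℝ => x) 2 P) (hQ : MemLp (fun y : J → ℝ => y) 2 Q)
    (B : Set (Matrix I J ℝ)) (hB : IsCompactBasis B)
    (π : Measure ((I → ℝ) × (J → ℝ))) (hπ : π ∈ couplings P Q) :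
    List.TFAE
      [PositiveExtremeDependence B P Q π,
        ∃ M ∈ B, IsLUB ((fun π' => (Mᵀ * crossCov π').trace) '' couplings P Q)
          (Mᵀ * crossCov π).trace,
        ∃ M ∈ B, IsLUB ((fun π' => ∫ z, z.1 ⬝ᵥ (M *ᵥ z.2) ∂π') '' couplings P Q)
          (∫ z, z.1 ⬝ᵥ (M *ᵥ z.2) ∂π),
        ∃ M ∈ B, ∃ u : (I → ℝ) → EReal, IsProperConvex u ∧
          ∀ᵐ z ∂π, M *ᵥ z.2 ∈ subdiff u z.1] ∧
    (PositiveExtremeDependence B P Q π → ExtremeDependence P Q π) := by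
  have hσ : crossCov π ∈ covarianceSet P Q := ⟨π, hπ, fun _ _ => rfl⟩
  have hmax : PositiveExtremeDependence B P Q π ↔
      ∃ M ∈ B, ∀ A' ∈ covarianceSet P Q, matDot M A' ≤ matDot M (crossCov π) :=
    (and_iff_right hπ).trans (isConicMaximal_iff hB (convex_covarianceSet hP hQ) hσ)
  constructor
  · tfae_have 1 ↔ 2 := by
      rw [hmax]
      refine exists_congr fun M => and_congr_right fun _ => ?_
      rw [covarianceSet_eq_image, Set.forall_mem_image]
      exact (isLUB_image_iff_of_mem (f := fun π' => (Mᵀ * crossCov π').trace) hπ).symm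
    tfae_have 2 ↔ 3 := by
      refine exists_congr fun M => and_congr_right fun _ => ?_
      refine (isLUB_image_iff_of_mem (f := fun π' => (Mᵀ * crossCov π').trace) hπ).trans
        (Iff.trans ?_ (isLUB_image_iff_of_mem
          (f := fun π' => ∫ z, z.1 ⬝ᵥ (M *ᵥ z.2) ∂π') hπ).symm)
      refine forall₂_congr fun π' hπ' => ?_
      rw [← matDot_crossCov hP hQ hπ' M, ← matDot_crossCov hP hQ hπ M]
      rfl
    tfae_have 3 ↔ 4 := by
      refine exists_congr fun M => and_congr_right fun _ => ?_
      refine (isLUB_image_iff_of_mem (f := fun π' => ∫ z, z.1 ⬝ᵥ (M *ᵥ z.2) ∂π') hπ).trans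
        ⟨exists_ae_mem_subdiff_of_forall_integral_le hP hQ hπ, ?_⟩
      rintro ⟨u, -, hu⟩ π' hπ'
      exact integral_le_of_ae_mem_subdiff hP hQ hπ hu hπ'
    tfae_finish
  · intro h
    obtain ⟨M, hM, hle⟩ := hmax.1 h
    -- As `M ≠ 0`, a maximiser of its form lies in the set but not in its interior.
    exact ⟨hπ, subset_closure hσ, notMem_interior_of_forall_matDot_le
      (fun h0 => hB.zero_notMem (h0 ▸ hM)) hle⟩
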